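/- Let $n,h\ge 1$ be integers. In the adversarial-order secretary problem with a history sample of size $h$ ($h$-AO-SP), an adversary picks a set $C$ of $n+h$ candidates with distinct non-negative real values. A subset $H\subseteq C$ of size $h$ is drawn uniformly at random and is revealed, together with $n$, to the online player. Having seen $H$, the adversary picks an ordering $c_1,\dots,c_n$ of the online set $O=C\setminus H$, and the candidates are presented one by one in this order. After each arrival the player, who knows $n$, $H$ and the values of the candidates that have arrived so far and may use internal randomness independent of $H$, immediately and irrevocably accepts or rejects the current candidate; the game ends when she accepts one. Let $\mathrm{ALG}$ be the value of the accepted candidate ($0$ if none is accepted) and let $\mathrm{OPT}=\max O$. A (possibly randomized) online algorithm is $c$-competitive on instances with $n$ online candidates if $\mathbb{E}[\mathrm{ALG}]\ge c\cdot\mathbb{E}[\mathrm{OPT}]$ for every such set $C$ and every way for the adversary to choose the ordering as a function of $H$, the expectations being over $H$ and the internal randomness. Theorem. If an online algorithm for the $h$-AO-SP is $c$-competitive on instances with $n$ online candidates, then $$c\le \frac{h}{n+h-1}.$$ -/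

import Mathlib

open MeasureTheory
open scoped NNReal BigOperators

namespace AOSP

/-- A (randomized) online algorithm for the adversarial-order secretary problem with a sample.
`Ω` is the space of outcomes of the internal randomness. In each round the player knows the number
`n` of online candidates, the (unordered) history set `H` and the list `seen` of all online
candidates that have arrived so far, in order of arrival and ending with the current one;
`accept n H seen` is the event that she accepts the current candidate, if she has not accepted a
candidate before. Candidates are identified with their values. -/
structure OnlineAlgorithm (Ω : Type*) [MeasurableSpace Ω] where
  accept : ℕ → Finset ℝ≥0 → List ℝ≥0 → Set Ω
  measurableSet_accept : ∀ n H seen, MeasurableSet (accept n H seen)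

namespace OnlineAlgorithm

variable {Ω : Type*} [MeasurableSpace Ω]

/-- The event that, on history set `H` and arrival sequence `l`, the candidate in position `i`
(counted from `0`) is the one the player accepts: she rejects all earlier candidates and then
accepts this one. -/
def acceptsAt (A : OnlineAlgorithm Ω) (n : ℕ) (H : Finset ℝ≥0) (l : List ℝ≥0) (i : ℕ) : Set Ω :=
  {ω | ω ∈ A.accept n H (l.take (i + 1)) ∧ ∀ j < i, ω ∉ A.accept n H (l.take (j + 1))}

/-- The value of the candidate accepted by the player on history set `H` and arrival sequence `l`,
and `0` if she accepts no candidate. The events `acceptsAt` are pairwise disjoint, so at most one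
term of the sum does not vanish. -/
noncomputable def gain (A : OnlineAlgorithm Ω) (n : ℕ) (H : Finset ℝ≥0) (l : List ℝ≥0) (ω : Ω) :
    ℝ :=
  ∑ i : Fin l.length, (A.acceptsAt n H l i).indicator (fun _ => ((l.get i : ℝ≥0) : ℝ)) ω

end OnlineAlgorithm

/-- `order` is an ordering strategy of the adversary on the candidate set `C`: once a history set
`H ⊆ C` of size `h` is drawn, `order H` lists the online set `C \ H`, each candidate once. -/
def IsArrivalOrder (C : Finset ℝ≥0) (h : ℕ) (order : Finset ℝ≥0 → List ℝ≥0) : Prop :=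
  ∀ H ∈ C.powersetCard h, (order H).Nodup ∧ (order H).toFinset = C \ H

/-- The expected value of the best online candidate, over a uniformly random history set of
size `h`. -/
noncomputable def expectedOpt (C : Finset ℝ≥0) (h : ℕ) : ℝ :=
  𝔼 H ∈ C.powersetCard h, (((C \ H).sup id : ℝ≥0) : ℝ)

namespace OnlineAlgorithm

variable {Ω : Type*} [MeasurableSpace Ω]

/-- The expected value of the accepted candidate, over a uniformly random history set of size `h`
and the internal randomness `μ` of the algorithm (independent of the history set), against the
ordering strategy `order`. -/
noncomputable def expectedGain (A : OnlineAlgorithm Ω) (μ : Measure Ω) (n : ℕ) (C : Finset ℝ≥0)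
    (h : ℕ) (order : Finset ℝ≥0 → List ℝ≥0) : ℝ :=
  𝔼 H ∈ C.powersetCard h, ∫ ω, A.gain n H (order H) ω ∂μ

/-- The algorithm is `c`-competitive on the instances with `n` online candidates and a history set
of size `h`: whatever set of `n + h` candidates (with distinct values) and whatever arrival order,
depending on the history set, the adversary picks, `E[ALG] ≥ c * E[OPT]`. -/
def IsCompetitive (A : OnlineAlgorithm Ω) (μ : Measure Ω) (n h : ℕ) (c : ℝ) : Prop :=
  ∀ C : Finset ℝ≥0, C.card = n + h →
    ∀ order : Finset ℝ≥0 → List ℝ≥0, IsArrivalOrder C h order →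
      c * expectedOpt C h ≤ A.expectedGain μ n C h order

end OnlineAlgorithm

end AOSP

/-! By a Ramsey-type argument, the algorithm can be treated as ignoring values. For a list with
history its first `h` entries and the rest arriving in increasing order, consider the probability of
accepting the last entry. On all sublists of a suitable list of `n + h` values, this is within `ε`
of some `p` of the length (`exists_list_forall_sublist_near`). Values grow so fast that only the
maximum `M` matters.

The adversary presents the candidates above all of `H` first, in increasing order. If `M ∉ H`, then
`M` arrives as number `k = |above C H|` and is taken with probability about `p (h + k)`. Acceptances
at different positions of one run are disjoint, so `∑ p (h + k) ≤ 1` up to `ε`-terms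
(`sum_lastAcceptProb_take_le_one`), and each `k` arises from at most `(n+h-2).choose (h-1)` sets `H`
(`card_filter_card_above_le`). Since `M` is online for `(n+h-1).choose h` sets, the ratio of the two
binomials bounds `c`. -/

namespace Ultrafilter

/-! ### Generic lists along an ultrafilter -/

/-- The ultrafilter of lists of length `m` whose entries are chosen one after the other, from the
head on, each generically with respect to `U`. -/
def iteratedList {α : Type*} (U : Ultrafilter α) : ℕ → Ultrafilter (List α)
  | 0 => pure []
  | m + 1 => U.bind fun x => (iteratedList U m).map (x :: ·)

section

variable {α : Type*} {U : Ultrafilter α}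

theorem eventually_iteratedList_zero {P : List α → Prop} :
    (∀ᶠ l in (U.iteratedList 0 : Filter (List α)), P l) ↔ P [] :=
  Iff.rfl

theorem eventually_iteratedList_succ {m : ℕ} {P : List α → Prop} :
    (∀ᶠ l in (U.iteratedList (m + 1) : Filter (List α)), P l) ↔
      ∀ᶠ x in (U : Filter α), ∀ᶠ l in (U.iteratedList m : Filter (List α)), P (x :: l) :=
  Iff.rfl

theorem eventually_length_iteratedList (U : Ultrafilter α) (m : ℕ) :
    ∀ᶠ l in (U.iteratedList m : Filter (List α)), l.length = m := by
  induction m with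
  | zero => exact eventually_iteratedList_zero.2 rfl
  | succ m ih =>
    exact eventually_iteratedList_succ.2 <| .of_forall fun x => ih.mono fun l hl => by simp [hl]

theorem eventually_forall_mem_iteratedList {P : α → Prop} (hP : ∀ᶠ x in (U : Filter α), P x)
    (m : ℕ) : ∀ᶠ l in (U.iteratedList m : Filter (List α)), ∀ x ∈ l, P x := by
  induction m with
  | zero => exact eventually_iteratedList_zero.2 (by simp)
  | succ m ih =>
    exact eventually_iteratedList_succ.2 <| hP.mono fun x hx => ih.mono fun l hl =>
      List.forall_mem_cons.2 ⟨hx, hl⟩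

theorem eventually_pairwise_iteratedList {R : α → α → Prop}
    (hR : ∀ x, ∀ᶠ y in (U : Filter α), R x y) (m : ℕ) :
    ∀ᶠ l in (U.iteratedList m : Filter (List α)), l.Pairwise R := by
  induction m with
  | zero => exact eventually_iteratedList_zero.2 .nil
  | succ m ih =>
    refine eventually_iteratedList_succ.2 <| .of_forall fun x => ?_
    filter_upwards [ih, eventually_forall_mem_iteratedList (hR x) m] with l hl hx
    exact .cons hx hl

/-- A property that is generic for lists of each length up to `m` holds generically for all
sublists of a list of length `m`. -/
theorem eventually_forall_sublist_iteratedList {m : ℕ} {P : List α → Prop}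
    (hP : ∀ k ≤ m, ∀ᶠ l in (U.iteratedList k : Filter (List α)), P l) :
    ∀ᶠ l in (U.iteratedList m : Filter (List α)), ∀ l', l'.Sublist l → P l' := by
  induction m generalizing P with
  | zero =>
    refine eventually_iteratedList_zero.2 fun l' hl' => ?_
    rw [List.sublist_nil.1 hl']
    exact eventually_iteratedList_zero.1 (hP 0 le_rfl)
  | succ m ih =>
    have h₁ := ih fun k hk => hP k (hk.trans m.le_succ)
    -- A sublist of `x :: l` either omits `x` or keeps it. The second case imposes only finitely
    -- many conditions on `x`, one per length.
    have h₂ : ∀ᶠ x in (U : Filter α), ∀ k ∈ Finset.range (m + 1),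
        ∀ᶠ l in (U.iteratedList k : Filter (List α)), P (x :: l) := by
      rw [Filter.eventually_all_finset]
      intro k hk
      exact eventually_iteratedList_succ.1 (hP (k + 1) (Nat.succ_le_of_lt (Finset.mem_range.1 hk)))
    refine eventually_iteratedList_succ.2 <| h₂.mono fun x hx => ?_
    have h₃ := ih (P := fun l => P (x :: l)) fun k hk =>
      hx k (Finset.mem_range.2 (Nat.lt_succ_of_le hk))
    filter_upwards [h₁, h₃] with l hl₁ hl₃ l' hl'
    rcases List.sublist_cons_iff.1 hl' with h | ⟨r, rfl, h⟩
    exacts [hl₁ _ h, hl₃ _ h]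

end

end Ultrafilter

/-! ### Nearly homogeneous, rapidly increasing lists -/

namespace AOSP

/-- Every `[0, 1]`-valued function of lists is almost determined by the length on the sublists of
suitable rapidly increasing lists. -/
theorem exists_list_forall_sublist_near (Q : List ℝ≥0 → ℝ) (hQ : ∀ l, Q l ∈ Set.Icc (0 : ℝ) 1) :
    ∃ p : ℕ → ℝ, (∀ k, 0 ≤ p k) ∧ ∀ (m : ℕ) (ε : ℝ), 0 < ε → ∃ l : List ℝ≥0, l.length = m ∧
      l.Pairwise (· < ·) ∧ (∀ x ∈ l, ∀ y ∈ l, x < y → (x : ℝ) ≤ ε * y) ∧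
      ∀ l', l'.Sublist l → |Q l' - p l'.length| < ε := by
  -- Refining `atTop` makes each new entry exceed any prescribed multiple of the earlier ones;
  -- compactness of `[0, 1]` then supplies the limits `p k`.
  obtain ⟨U, hU⟩ := Ultrafilter.exists_le (Filter.atTop : Filter ℝ≥0)
  have hp : ∀ k, ∃ a ∈ Set.Icc (0 : ℝ) 1,
      Filter.Tendsto Q (U.iteratedList k : Filter (List ℝ≥0)) (nhds a) := fun k =>
    isCompact_iff_ultrafilter_le_nhds'.1 isCompact_Icc ((U.iteratedList k).map Q)
      (Ultrafilter.mem_map.2 (Filter.univ_mem' hQ))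
  choose p hp₀ hp using hp
  refine ⟨p, fun k => (hp₀ k).1, fun m ε hε => ?_⟩
  have h₁ : ∀ᶠ l in (U.iteratedList m : Filter (List ℝ≥0)), ∀ l', l'.Sublist l →
      |Q l' - p l'.length| < ε := by
    refine Ultrafilter.eventually_forall_sublist_iteratedList fun k _ => ?_
    filter_upwards [Metric.tendsto_nhds.1 (hp k) ε hε, U.eventually_length_iteratedList k]
      with l hl hk
    rwa [hk, ← Real.dist_eq]
  have h₂ : ∀ x : ℝ≥0, ∀ᶠ y in (U : Filter ℝ≥0), x < y ∧ (x : ℝ) ≤ ε * y := by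
    refine fun x => hU ?_
    filter_upwards [Filter.eventually_gt_atTop x,
      Filter.eventually_ge_atTop (x / ⟨ε, hε.le⟩ : ℝ≥0)] with y hy hxy
    refine ⟨hy, ?_⟩
    have : (x : ℝ) / ε ≤ y := by exact_mod_cast hxy
    rwa [div_le_iff₀' hε] at this
  obtain ⟨l, h₁, h₂, h₃⟩ := (h₁.and ((Ultrafilter.eventually_pairwise_iteratedList h₂ m).and
    (U.eventually_length_iteratedList m))).exists
  refine ⟨l, h₃, h₂.imp And.left, fun x hx y hy hxy => ?_, h₁⟩
  obtain ⟨i, hi, rfl⟩ := List.getElem_of_mem hx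
  obtain ⟨j, hj, rfl⟩ := List.getElem_of_mem hy
  rw [List.pairwise_iff_getElem] at h₂
  rcases lt_trichotomy i j with h | rfl | h
  · exact (h₂ i j hi hj h).2
  · exact absurd hxy (lt_irrefl _)
  · exact absurd hxy (h₂ j i hj hi h).1.not_gt

/-! ### Acceptance probabilities -/

namespace OnlineAlgorithm

variable {Ω : Type*} [MeasurableSpace Ω]

theorem measurableSet_acceptsAt (A : OnlineAlgorithm Ω) (n : ℕ) (H : Finset ℝ≥0) (l : List ℝ≥0)
    (i : ℕ) : MeasurableSet (A.acceptsAt n H l i) := by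
  have : A.acceptsAt n H l i = A.accept n H (l.take (i + 1)) ∩
      ⋂ j, ⋂ (_ : j < i), (A.accept n H (l.take (j + 1)))ᶜ := by
    ext ω
    simp [acceptsAt]
  rw [this]
  exact (A.measurableSet_accept _ _ _).inter <| .iInter fun j => .iInter fun _ =>
    (A.measurableSet_accept _ _ _).compl

/-- This is where being online enters: arrivals after position `i` cannot influence the decision
there. -/
theorem acceptsAt_congr (A : OnlineAlgorithm Ω) (n : ℕ) (H : Finset ℝ≥0) {l l' : List ℝ≥0} {i : ℕ}
    (h : l.take (i + 1) = l'.take (i + 1)) : A.acceptsAt n H l i = A.acceptsAt n H l' i := by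
  have key : ∀ j < i, l.take (j + 1) = l'.take (j + 1) := fun j hj => by
    have := congrArg (List.take (j + 1)) h
    rwa [List.take_take, List.take_take, min_eq_left (by omega)] at this
  ext ω
  simp only [acceptsAt, Set.mem_ofPred_eq, h]
  refine and_congr_right fun _ => forall₂_congr fun j hj => by rw [key j hj]

theorem pairwise_disjoint_acceptsAt (A : OnlineAlgorithm Ω) (n : ℕ) (H : Finset ℝ≥0)
    (l : List ℝ≥0) : Pairwise (Function.onFun Disjoint (A.acceptsAt n H l)) := by
  intro i j hij
  refine Set.disjoint_left.2 fun ω hi hj => ?_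
  rcases lt_or_gt_of_ne hij with h | h
  exacts [hj.2 i h hi.1, hi.2 j h hj.1]

variable (μ : Measure Ω) [IsProbabilityMeasure μ]

theorem sum_measureReal_acceptsAt_le_one (A : OnlineAlgorithm Ω) (n : ℕ) (H : Finset ℝ≥0)
    (l : List ℝ≥0) (m : ℕ) : ∑ i ∈ Finset.range m, μ.real (A.acceptsAt n H l i) ≤ 1 := by
  rw [← measureReal_biUnion_finset
    (fun i _ j _ hij => A.pairwise_disjoint_acceptsAt n H l hij)
    (fun i _ => A.measurableSet_acceptsAt n H l i)]
  exact measureReal_le_one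

theorem integral_gain (A : OnlineAlgorithm Ω) (n : ℕ) (H : Finset ℝ≥0) (l : List ℝ≥0) :
    ∫ ω, A.gain n H l ω ∂μ =
      ∑ i : Fin l.length, μ.real (A.acceptsAt n H l i) * ((l.get i : ℝ≥0) : ℝ) := by
  unfold gain
  rw [integral_finsetSum (μ := μ) Finset.univ fun (i : Fin l.length) _ =>
    (integrable_const ((l.get i : ℝ≥0) : ℝ)).indicator (A.measurableSet_acceptsAt n H l i)]
  refine Finset.sum_congr rfl fun i _ => ?_
  rw [integral_indicator_const _ (A.measurableSet_acceptsAt n H l i), smul_eq_mul]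

/-- Acceptance probabilities have total at most `1`, so the common bound `b` is paid only once. -/
theorem integral_gain_le (A : OnlineAlgorithm Ω) (n : ℕ) (H : Finset ℝ≥0) (l : List ℝ≥0) {b M : ℝ}
    (hb : 0 ≤ b) (hM : 0 ≤ M) (j : ℕ)
    (hl : ∀ i : Fin l.length, ((l.get i : ℝ≥0) : ℝ) ≤ b + if (i : ℕ) = j then M else 0) :
    ∫ ω, A.gain n H l ω ∂μ ≤ b + M * μ.real (A.acceptsAt n H l j) := by
  rw [integral_gain]
  calc _ ≤ ∑ i : Fin l.length, μ.real (A.acceptsAt n H l i) * (b + if (i : ℕ) = j then M else 0) :=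
        Finset.sum_le_sum fun i _ => mul_le_mul_of_nonneg_left (hl i) measureReal_nonneg
    _ = (∑ i ∈ Finset.range l.length, μ.real (A.acceptsAt n H l i)) * b +
        ∑ i ∈ Finset.range l.length, if i = j then μ.real (A.acceptsAt n H l i) * M else 0 := by
      rw [Fin.sum_univ_eq_sum_range
        (fun i => μ.real (A.acceptsAt n H l i) * (b + if i = j then M else 0)), Finset.sum_mul,
        ← Finset.sum_add_distrib]
      refine Finset.sum_congr rfl fun i _ => ?_
      split_ifs <;> ring
    _ ≤ 1 * b + M * μ.real (A.acceptsAt n H l j) := by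
      refine add_le_add (mul_le_mul_of_nonneg_right
        (A.sum_measureReal_acceptsAt_le_one μ n H l _) hb) ?_
      rw [Finset.sum_ite_eq']
      split_ifs
      · rw [mul_comm]
      · exact mul_nonneg hM measureReal_nonneg
    _ = _ := by rw [one_mul]

/-- The probability that the player accepts the last entry of `l` after the history set formed by
the first `h` entries, the other entries arriving in the order of `l`. -/
noncomputable def lastAcceptProb (A : OnlineAlgorithm Ω) (n h : ℕ) (l : List ℝ≥0) : ℝ :=
  μ.real (A.acceptsAt n (l.take h).toFinset (l.drop h) (l.length - h - 1))

/-- All these prefixes share one history set and belong to a single run, so the summands are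
probabilities of disjoint events. -/
theorem sum_lastAcceptProb_take_le_one (A : OnlineAlgorithm Ω) (n h : ℕ) {l : List ℝ≥0}
    (hl : l.length = n + h) :
    ∑ k ∈ Finset.Icc 1 n, A.lastAcceptProb μ n h (l.take (h + k)) ≤ 1 := by
  calc _ = ∑ i ∈ Finset.range n, μ.real (A.acceptsAt n (l.take h).toFinset (l.drop h) i) := by
        have hIcc : Finset.Icc 1 n = Finset.Ico (0 + 1) (n + 1) := by ext; simp
        rw [hIcc, ← Finset.sum_Ico_add', ← Finset.range_eq_Ico]
        refine Finset.sum_congr rfl fun i hi => ?_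
        have hi := Finset.mem_range.1 hi
        unfold lastAcceptProb
        rw [List.length_take, List.take_take, min_eq_left (by omega : h ≤ h + (i + 1)),
          min_eq_left (by omega : h + (i + 1) ≤ l.length),
          show h + (i + 1) - h - 1 = i by omega]
        congr 1
        refine A.acceptsAt_congr _ _ ?_
        rw [List.drop_take, List.take_take, show h + (i + 1) - h = i + 1 by omega, min_self]
    _ ≤ 1 := A.sum_measureReal_acceptsAt_le_one μ _ _ _ _

end OnlineAlgorithm

/-! ### Counting history sets -/

/-- The candidates in `C` that are better than everything in the history set `H`. -/
noncomputable def above (C H : Finset ℝ≥0) : Finset ℝ≥0 :=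
  C.filter fun x => ∀ z ∈ H, z < x

/-- The number `k` determines the maximum `z ≠ M` of `H`; the other `h - 1` elements lie in `C`
without `M` and `z`. -/
theorem card_filter_card_above_le {C : Finset ℝ≥0} {M : ℝ≥0} (hM : M ∈ C) {h : ℕ} (hh : 1 ≤ h)
    (k : ℕ) :
    (((C.powersetCard h).filter (M ∉ ·)).filter fun H => (above C H).card = k).card ≤
      (C.card - 2).choose (h - 1) := by
  set S := ((C.powersetCard h).filter (M ∉ ·)).filter fun H => (above C H).card = k with hS
  have hSmem : ∀ H ∈ S, H ⊆ C ∧ H.card = h ∧ M ∉ H ∧ (above C H).card = k := by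
    intro H hH
    simpa [hS, Finset.mem_powersetCard, and_assoc] using hH
  have hne : ∀ H ∈ S, H.Nonempty := fun H hH =>
    Finset.card_pos.1 (by rw [(hSmem H hH).2.1]; omega)
  -- A larger maximum strictly shrinks `above`, which is impossible at equal cardinality.
  have hlt : ∀ H ∈ S, ∀ H' ∈ S, ∀ hH : H.Nonempty, ∀ hH' : H'.Nonempty,
      ¬ H.max' hH < H'.max' hH' := by
    intro H hHS H' hHS' hH hH' hlt
    have hsub : above C H' ⊂ above C H := by
      refine Finset.ssubset_iff_of_subset ?_ |>.2 ⟨H'.max' hH', ?_, ?_⟩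
      · intro x hx
        rw [above, Finset.mem_filter] at hx ⊢
        exact ⟨hx.1, fun z hz => (Finset.le_max' H z hz).trans_lt
          (hlt.trans (hx.2 _ (H'.max'_mem hH')))⟩
      · rw [above, Finset.mem_filter]
        exact ⟨(hSmem H' hHS').1 (H'.max'_mem hH'), fun z hz => (Finset.le_max' H z hz).trans_lt hlt⟩
      · rw [above, Finset.mem_filter]
        exact fun hx => lt_irrefl _ (hx.2 _ (H'.max'_mem hH'))
    have := Finset.card_lt_card hsub
    rw [(hSmem H hHS).2.2.2, (hSmem H' hHS').2.2.2] at this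
    exact lt_irrefl _ this
  rcases S.eq_empty_or_nonempty with h0 | ⟨H₀, hH₀⟩
  · simp [h0]
  set z := H₀.max' (hne H₀ hH₀) with hz
  have hzmem : ∀ H ∈ S, z ∈ H := fun H hH => by
    have : H.max' (hne H hH) = z := le_antisymm
      (not_lt.1 (hlt H₀ hH₀ H hH _ _)) (not_lt.1 (hlt H hH H₀ hH₀ _ _))
    rw [← this]
    exact H.max'_mem _
  have hzC : z ∈ C := (hSmem H₀ hH₀).1 (hzmem H₀ hH₀)
  have hzM : z ≠ M := fun h => (hSmem H₀ hH₀).2.2.1 (h ▸ hzmem H₀ hH₀)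
  have hcard : ((C.erase M).erase z).card = C.card - 2 := by
    rw [Finset.card_erase_of_mem (Finset.mem_erase.2 ⟨hzM, hzC⟩), Finset.card_erase_of_mem hM]
    omega
  rw [← hcard, ← Finset.card_powersetCard]
  refine Finset.card_le_card_of_injOn (fun H => H.erase z) (fun H hH => ?_)
    (fun H hH H' hH' heq => ?_)
  · obtain ⟨h₁, h₂, h₃, -⟩ := hSmem H hH
    refine Finset.mem_coe.2 (Finset.mem_powersetCard.2 ⟨?_, ?_⟩)
    · exact Finset.erase_subset_erase z
        fun x hx => Finset.mem_erase.2 ⟨fun h => h₃ (h ▸ hx), h₁ hx⟩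
    · rw [Finset.card_erase_of_mem (hzmem H hH), h₂]
  · rw [← Finset.insert_erase (hzmem H hH), ← Finset.insert_erase (hzmem H' hH')]
    exact congrArg _ heq

end AOSP

/-! ### The adversary's ordering -/

namespace AOSP

/-- The adversary's ordering: first the candidates better than the whole history set, from worst to
best, then the others. -/
noncomputable def aboveFirst (C H : Finset ℝ≥0) : List ℝ≥0 :=
  (above C H).sort ++ ((C \ H) \ above C H).sort

theorem above_subset_sdiff (C H : Finset ℝ≥0) : above C H ⊆ C \ H := fun x hx => by
  rw [above, Finset.mem_filter] at hx
  exact Finset.mem_sdiff.2 ⟨hx.1, fun h => lt_irrefl _ (hx.2 x h)⟩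

theorem nodup_aboveFirst (C H : Finset ℝ≥0) : (aboveFirst C H).Nodup :=
  (Finset.sort_nodup _ _).append (Finset.sort_nodup _ _) fun x hx hx' => by
    rw [Finset.mem_sort] at hx hx'
    exact (Finset.mem_sdiff.1 hx').2 hx

theorem toFinset_aboveFirst (C H : Finset ℝ≥0) : (aboveFirst C H).toFinset = C \ H := by
  rw [aboveFirst, List.toFinset_append, Finset.sort_toFinset, Finset.sort_toFinset,
    Finset.union_sdiff_of_subset (above_subset_sdiff C H)]

theorem isArrivalOrder_aboveFirst (C : Finset ℝ≥0) (h : ℕ) :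
    IsArrivalOrder C h (aboveFirst C) := fun H _ =>
  ⟨nodup_aboveFirst C H, toFinset_aboveFirst C H⟩

/-- This makes the run up to the arrival of the maximum an instance of the near-homogeneity. -/
theorem sort_append_sort_above_sublist {l : List ℝ≥0} (hl : l.Pairwise (· < ·))
    {H : Finset ℝ≥0} (hH : H ⊆ l.toFinset) :
    (H.sort ++ (above l.toFinset H).sort).Sublist l := by
  have hs : (H.sort ++ (above l.toFinset H).sort).Pairwise (· < ·) := by
    refine List.pairwise_append.2 ⟨(Finset.sortedLT_sort _).pairwise,
      (Finset.sortedLT_sort _).pairwise, fun x hx y hy => ?_⟩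
    rw [Finset.mem_sort] at hx hy
    exact (Finset.mem_filter.1 hy).2 x hx
  refine List.sublist_of_subperm_of_pairwise (List.subperm_of_subset (hs.imp ne_of_lt) ?_) hs hl
  intro x hx
  rw [List.mem_append, Finset.mem_sort, Finset.mem_sort] at hx
  rcases hx with hx | hx
  · exact List.mem_toFinset.1 (hH hx)
  · exact List.mem_toFinset.1 (Finset.mem_filter.1 hx).1

theorem eq_of_getElem_aboveFirst_eq {C H : Finset ℝ≥0} {M : ℝ≥0} (hM : M ∈ above C H)
    (hmax : ∀ x ∈ C, x ≤ M) {i : ℕ} (hi : i < (aboveFirst C H).length)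
    (h : (aboveFirst C H)[i] = M) : i = (above C H).card - 1 := by
  obtain ⟨j, hj, hjM⟩ := List.getElem_of_mem ((Finset.mem_sort (· ≤ ·)).2 hM)
  have hj' : j < (aboveFirst C H).length := by
    rw [aboveFirst, List.length_append]; omega
  have hjM' : (aboveFirst C H)[j] = M := by
    simp only [aboveFirst, List.getElem_append_left hj, hjM]
  have hij : i = j := (nodup_aboveFirst C H).getElem_inj_iff.1 (h.trans hjM'.symm)
  have hlast : j = (above C H).card - 1 := by
    by_contra hne
    rw [Finset.length_sort] at hj
    have hk : (above C H).card - 1 < ((above C H).sort).length := by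
      rw [Finset.length_sort]; omega
    have hlt := List.pairwise_iff_getElem.1 (Finset.sortedLT_sort (above C H)).pairwise j
      ((above C H).card - 1) (by rw [Finset.length_sort]; omega) hk (by omega)
    rw [hjM] at hlt
    have hmem := (Finset.mem_sort (· ≤ ·)).1 (List.getElem_mem hk)
    exact hlt.not_ge (hmax _ (Finset.mem_filter.1 hmem).1)
  rw [hij, hlast]

theorem mem_above {C H : Finset ℝ≥0} {M : ℝ≥0} (hM : M ∈ C) (hmax : ∀ x ∈ C, x ≤ M)
    (hH : H ⊆ C) (hMH : M ∉ H) : M ∈ above C H :=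
  Finset.mem_filter.2 ⟨hM, fun z hz => lt_of_le_of_ne (hmax z (hH hz)) fun h => hMH (h ▸ hz)⟩

/-! ### The competitiveness inequality -/

namespace OnlineAlgorithm

variable {Ω : Type*} [MeasurableSpace Ω] (μ : Measure Ω)

theorem lastAcceptProb_sort_append_sort_above (A : OnlineAlgorithm Ω) (n : ℕ)
    {C H : Finset ℝ≥0} (hne : (above C H).Nonempty) :
    A.lastAcceptProb μ n H.card (H.sort ++ (above C H).sort) =
      μ.real (A.acceptsAt n H (aboveFirst C H) ((above C H).card - 1)) := by
  have ht : (H.sort ++ (above C H).sort).take H.card = H.sort := by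
    rw [List.take_append_of_le_length (by rw [Finset.length_sort]),
      List.take_of_length_le (by rw [Finset.length_sort])]
  have hd : (H.sort ++ (above C H).sort).drop H.card = (above C H).sort :=
    List.drop_left' (Finset.length_sort _)
  unfold lastAcceptProb
  rw [ht, hd, Finset.sort_toFinset, List.length_append, Finset.length_sort, Finset.length_sort,
    Nat.add_sub_cancel_left]
  congr 1
  refine A.acceptsAt_congr _ _ ?_
  rw [aboveFirst, List.take_append_of_le_length]
  rw [Finset.length_sort, Nat.sub_add_cancel hne.card_pos]

variable [IsProbabilityMeasure μ]

theorem integral_gain_aboveFirst_le (A : OnlineAlgorithm Ω) (n : ℕ) {C H : Finset ℝ≥0} {M : ℝ≥0}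
    {ε : ℝ} (hε : 0 ≤ ε) (hM : M ∈ C) (hmax : ∀ x ∈ C, x ≤ M)
    (hgrow : ∀ x ∈ C, x < M → (x : ℝ) ≤ ε * M) (hH : H ⊆ C) :
    ∫ ω, A.gain n H (aboveFirst C H) ω ∂μ ≤ ε * M + if M ∉ H then
      M * A.lastAcceptProb μ n H.card (H.sort ++ (above C H).sort) else 0 := by
  have hmem : ∀ i : Fin (aboveFirst C H).length, (aboveFirst C H).get i ∈ C \ H := fun i => by
    rw [← toFinset_aboveFirst, List.mem_toFinset]
    exact List.get_mem _ _
  have hεM : 0 ≤ ε * M := mul_nonneg hε M.2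
  by_cases hMH : M ∉ H
  · rw [if_pos hMH, lastAcceptProb_sort_append_sort_above μ A n ⟨M, mem_above hM hmax hH hMH⟩]
    refine A.integral_gain_le μ n H _ hεM M.2 _ fun i => ?_
    have hi := (Finset.mem_sdiff.1 (hmem i)).1
    split_ifs with hik
    · exact (NNReal.coe_le_coe.2 (hmax _ hi)).trans (le_add_of_nonneg_left hεM)
    · rw [add_zero]
      refine hgrow _ hi (lt_of_le_of_ne (hmax _ hi) fun h => hik ?_)
      exact eq_of_getElem_aboveFirst_eq (mem_above hM hmax hH hMH) hmax i.2 h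
  · have := A.integral_gain_le μ n H (aboveFirst C H) hεM le_rfl 0 fun i => by
      obtain ⟨hi, hi'⟩ := Finset.mem_sdiff.1 (hmem i)
      rw [ite_self, add_zero]
      exact hgrow _ hi (lt_of_le_of_ne (hmax _ hi) fun h => hi' (h ▸ not_not.1 hMH))
    rw [if_neg hMH]
    simpa using this

/-- The competitiveness inequality, up to `ε`, on a rapidly increasing set of candidates. -/
theorem IsCompetitive.mul_choose_le {A : OnlineAlgorithm Ω} {n h : ℕ} {c : ℝ} (hn : 1 ≤ n)
    (hh : 1 ≤ h) (hc₀ : 0 ≤ c) (hc : A.IsCompetitive μ n h c) {p : ℕ → ℝ} (hp : ∀ k, 0 ≤ p k)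
    {ε : ℝ} (hε : 0 < ε) {l : List ℝ≥0} (hlen : l.length = n + h) (hl : l.Pairwise (· < ·))
    (hgrow : ∀ x ∈ l, ∀ y ∈ l, x < y → (x : ℝ) ≤ ε * y)
    (hnear : ∀ l', l'.Sublist l → |A.lastAcceptProb μ n h l' - p l'.length| < ε) :
    c * ((n + h - 1).choose h : ℝ) ≤
      (n + h).choose h * (2 * ε) + (n + h - 2).choose (h - 1) * (1 + n * ε) := by
  set C := l.toFinset with hC
  have hCcard : C.card = n + h := by
    rw [hC, List.toFinset_card_of_nodup (hl.imp ne_of_lt), hlen]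
  have hCne : C.Nonempty := Finset.card_pos.1 (by omega)
  set M := C.max' hCne with hMdef
  have hM : M ∈ C := C.max'_mem hCne
  have hmax : ∀ x ∈ C, x ≤ M := fun x hx => C.le_max' x hx
  have hMpos : (0 : ℝ) < M := by
    obtain ⟨x, hx, hxM⟩ := Finset.exists_mem_ne (by omega : 1 < C.card) M
    exact NNReal.coe_pos.2 ((zero_le).trans_lt (lt_of_le_of_ne (hmax x hx) hxM))
  -- Near-homogeneity lets `p` be tested on the prefixes of `l`, a single run, although it is
  -- applied below to many different `H`.
  have hsump : ∑ k ∈ Finset.Icc 1 n, p (h + k) ≤ 1 + n * ε := by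
    calc ∑ k ∈ Finset.Icc 1 n, p (h + k)
        ≤ ∑ k ∈ Finset.Icc 1 n, (A.lastAcceptProb μ n h (l.take (h + k)) + ε) := by
          refine Finset.sum_le_sum fun k hk => ?_
          have hk := (Finset.mem_Icc.1 hk).2
          have := (abs_lt.1 (hnear _ (List.take_sublist (h + k) l))).1
          rw [List.length_take, min_eq_left (by omega)] at this
          linarith
      _ ≤ 1 + n * ε := by
          rw [Finset.sum_add_distrib, Finset.sum_const, Nat.card_Icc, nsmul_eq_mul,
            Nat.add_sub_cancel]
          exact add_le_add (A.sum_lastAcceptProb_take_le_one μ n h hlen) le_rfl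
  set S := (C.powersetCard h).filter (M ∉ ·) with hS
  have hcount : ∑ H ∈ S, p (h + (above C H).card) ≤
      (n + h - 2).choose (h - 1) * (1 + n * ε) := by
    have hmaps : ∀ H ∈ S, (above C H).card ∈ Finset.Icc 1 n := fun H hH => by
      obtain ⟨hH, hMH⟩ := Finset.mem_filter.1 hH
      obtain ⟨hHC, hHh⟩ := Finset.mem_powersetCard.1 hH
      refine Finset.mem_Icc.2 ⟨Finset.card_pos.2 ⟨M, mem_above hM hmax hHC hMH⟩, ?_⟩
      refine (Finset.card_le_card (above_subset_sdiff C H)).trans ?_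
      rw [Finset.card_sdiff_of_subset hHC]
      omega
    rw [← Finset.sum_fiberwise_of_maps_to hmaps]
    calc _ ≤ ∑ k ∈ Finset.Icc 1 n, ((n + h - 2).choose (h - 1) : ℝ) * p (h + k) := by
          refine Finset.sum_le_sum fun k _ => ?_
          rw [Finset.sum_congr rfl fun H hH => by rw [(Finset.mem_filter.1 hH).2],
            Finset.sum_const, nsmul_eq_mul]
          refine mul_le_mul_of_nonneg_right ?_ (hp _)
          have := card_filter_card_above_le hM hh k
          rw [hCcard] at this
          exact_mod_cast this
      _ ≤ _ := by
          rw [← Finset.mul_sum]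
          exact mul_le_mul_of_nonneg_left hsump (Nat.cast_nonneg _)
  -- In `2 * ε`, one `ε` bounds the gain from candidates below `M`, the other the error of replacing
  -- the acceptance probability by `p`.
  have hgain : ∑ H ∈ C.powersetCard h, ∫ ω, A.gain n H (aboveFirst C H) ω ∂μ ≤
      M * ((n + h).choose h * (2 * ε) + (n + h - 2).choose (h - 1) * (1 + n * ε)) := by
    calc _ ≤ ∑ H ∈ C.powersetCard h, (M * (2 * ε) +
          if M ∉ H then M * p (h + (above C H).card) else 0) := by
          refine Finset.sum_le_sum fun H hH => ?_
          obtain ⟨hHC, hHh⟩ := Finset.mem_powersetCard.1 hH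
          refine (A.integral_gain_aboveFirst_le μ n hε.le hM hmax (fun x hx => hgrow x
            (List.mem_toFinset.1 hx) M (List.mem_toFinset.1 hM)) hHC).trans ?_
          have := (abs_lt.1 (hnear _ (sort_append_sort_above_sublist hl hHC))).2
          rw [List.length_append, Finset.length_sort, Finset.length_sort, hHh] at this
          rw [hHh]
          split_ifs
          · nlinarith
          · nlinarith
      _ = M * ((n + h).choose h * (2 * ε) + ∑ H ∈ S, p (h + (above C H).card)) := by
          rw [Finset.sum_add_distrib, Finset.sum_const, Finset.card_powersetCard, hCcard,
            ← Finset.sum_filter, ← Finset.mul_sum, nsmul_eq_mul]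
          ring
      _ ≤ _ := by gcongr
  -- Only the history sets avoiding `M` are kept.
  have hopt : M * ((n + h - 1).choose h : ℝ) ≤
      ∑ H ∈ C.powersetCard h, (((C \ H).sup id : ℝ≥0) : ℝ) := by
    calc M * ((n + h - 1).choose h : ℝ) = ∑ H ∈ (C.erase M).powersetCard h, (M : ℝ) := by
          rw [Finset.sum_const, Finset.card_powersetCard, Finset.card_erase_of_mem hM, hCcard,
            nsmul_eq_mul, mul_comm]
      _ ≤ ∑ H ∈ (C.erase M).powersetCard h, (((C \ H).sup id : ℝ≥0) : ℝ) := by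
          refine Finset.sum_le_sum fun H hH => ?_
          have hMH : M ∉ H := fun h' =>
            Finset.notMem_erase M C ((Finset.mem_powersetCard.1 hH).1 h')
          exact NNReal.coe_le_coe.2 (Finset.le_sup (f := id) (Finset.mem_sdiff.2 ⟨hM, hMH⟩))
      _ ≤ _ := Finset.sum_le_sum_of_subset_of_nonneg
          (Finset.powersetCard_mono (Finset.erase_subset _ _)) fun _ _ _ => NNReal.coe_nonneg _
  have hcomp := hc C hCcard (aboveFirst C) (isArrivalOrder_aboveFirst C h)
  rw [expectedOpt, expectedGain, Finset.expect_eq_sum_div_card, Finset.expect_eq_sum_div_card,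
    ← mul_div_assoc, div_le_div_iff_of_pos_right] at hcomp
  · refine le_of_mul_le_mul_left ?_ hMpos
    calc _ = c * (M * ((n + h - 1).choose h : ℝ)) := by ring
      _ ≤ _ := (mul_le_mul_of_nonneg_left hopt hc₀).trans (hcomp.trans hgain)
  · rw [Finset.card_powersetCard, hCcard]
    exact_mod_cast Nat.choose_pos (by omega)

end OnlineAlgorithm

end AOSP

theorem mainTheorem1 {Ω : Type*} [MeasurableSpace Ω] (μ : Measure Ω) [IsProbabilityMeasure μ]
    (A : AOSP.OnlineAlgorithm Ω) (n h : ℕ) (hn : 1 ≤ n) (hh : 1 ≤ h) (c : ℝ)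
    (hc : A.IsCompetitive μ n h c) :
    c ≤ (h : ℝ) / ((n : ℝ) + (h : ℝ) - 1) := by
  have hn' : (1 : ℝ) ≤ n := by exact_mod_cast hn
  have hh' : (1 : ℝ) ≤ h := by exact_mod_cast hh
  -- The lower bound on the optimum can be multiplied by `c` only if `c ≥ 0`.
  rcases le_total c 0 with hc₀ | hc₀
  · exact hc₀.trans (div_nonneg (by linarith) (by linarith))
  obtain ⟨p, hp, hl⟩ := AOSP.exists_list_forall_sublist_near (A.lastAcceptProb μ n h)
    fun l => ⟨measureReal_nonneg, measureReal_le_one⟩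
  have key : c * ((n + h - 1).choose h : ℝ) ≤ (n + h - 2).choose (h - 1) := by
    -- `K` is the total coefficient of `ε` in `mul_choose_le`; dividing by `K + 1` avoids showing `K
    -- ≠ 0`.
    set K : ℝ := (n + h).choose h * 2 + (n + h - 2).choose (h - 1) * n with hK
    have hK₀ : 0 ≤ K := by positivity
    refine le_of_forall_pos_le_add fun δ hδ => ?_
    have hε : 0 < δ / (K + 1) := by positivity
    obtain ⟨l, hlen, hlt, hgrow, hnear⟩ := hl (n + h) _ hε
    have := hc.mul_choose_le μ hn hh hc₀ hp hε hlen hlt hgrow hnear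
    have hle : K * (δ / (K + 1)) ≤ δ := by
      rw [mul_div_assoc', div_le_iff₀ (by positivity)]
      nlinarith
    have hexp : K * (δ / (K + 1)) = (n + h).choose h * (2 * (δ / (K + 1))) +
      (n + h - 2).choose (h - 1) * (n * (δ / (K + 1))) := by
      rw [hK]; ring
    linarith
  have hpos : (0 : ℝ) < (n + h - 1).choose h := by
    exact_mod_cast Nat.choose_pos (by omega)
  have hid : ((n : ℝ) + h - 1) * (n + h - 2).choose (h - 1) = (n + h - 1).choose h * h := by
    have := Nat.add_one_mul_choose_eq (n + h - 2) (h - 1)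
    rw [show n + h - 2 + 1 = n + h - 1 by omega, show h - 1 + 1 = h by omega] at this
    have hcast : ((n + h - 1 : ℕ) : ℝ) = (n : ℝ) + h - 1 := by
      rw [Nat.cast_sub (by omega)]; push_cast; ring
    rw [← hcast]
    exact_mod_cast this
  rw [le_div_iff₀ (by linarith)]
  refine le_of_mul_le_mul_right ?_ hpos
  nlinarith
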